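/- Let $K$ be a field and let $A$ and $X$ be sets. A multi-Novikov algebra (over $K$, indexed by $A$) is a $K$-vector space with bilinear products $x,y\mapsto x\triangleright_a y$, $a\in A$, such that for all $a,b\in A$ and all elements $x,y,z$ $$(x \triangleright_a y) \triangleright_b z - x \triangleright_a (y \triangleright_b z) = (y \triangleright_a x) \triangleright_b z - y \triangleright_a (x \triangleright_b z),$$ $$(x \triangleright_a y) \triangleright_b z - x \triangleright_a (y \triangleright_b z) = (x\triangleright_b y) \triangleright_a z - x \triangleright_b (y \triangleright_a z),$$ $$(x \triangleright_a y) \triangleright_b z = (x \triangleright_b z)\triangleright_a y .$$ Let $\mathrm{Nov}_A\langle X\rangle$ be the free multi-Novikov algebra generated by $X$, that is, the quotient of the free algebra with bilinear operations $\triangleright_a$, $a\in A$, on the set $X$ by the ideal generated by these identities. Let $M(A)$ be the set of finitely supported maps $A\to\mathbb{N}$, and let $\mathrm{CDi}_A\langle X\rangle$ be the free commutative multidifferential algebra generated by $X$: the polynomial algebra over $K$ in the variables $(x,m)\in X\times M(A)$ with the pairwise commuting derivations $\partial_a$, $a\in A$, determined by $\partial_a(x,m)=(x,m_a)$, where $m_a(a')=m(a')+\delta_{a,a'}$;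 a generator $x\in X$ is identified with the variable $(x,0)$. Equip $\mathrm{CDi}_A\langle X\rangle$ with its canonical multi-Novikov structure $u\triangleright_a v=u\,\partial_a(v)$. Then $\mathrm{Nov}_A\langle X\rangle$ is isomorphic, as a multi-Novikov algebra, to the multi-Novikov subalgebra of $\mathrm{CDi}_A\langle X\rangle$ generated by $X$, by an isomorphism that sends each generator $x\in X$ of $\mathrm{Nov}_A\langle X\rangle$ to the generator $x=(x,0)$. -/

import Mathlib

noncomputable section

/-- A (left) multi-Novikov algebra over `K`, with operations indexed by the set `A`: a `K`-module `N`
with bilinear products `op a` (written `x ▷_a y` in mathematics), `a ∈ A`, subject to the three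
multi-Novikov identities. -/
class MultiNovikovAlgebra (K A N : Type*) [CommRing K] [AddCommGroup N] [Module K N] where
  /-- the bilinear product `x ▷_a y` -/
  op : A → N →ₗ[K] N →ₗ[K] N
  op_exchange_left : ∀ (a b : A) (x y z : N),
    op b (op a x y) z - op a x (op b y z) = op b (op a y x) z - op a y (op b x z)
  op_exchange_index : ∀ (a b : A) (x y z : N),
    op b (op a x y) z - op a x (op b y z) = op a (op b x y) z - op b x (op a y z)
  op_right_comm : ∀ (a b : A) (x y z : N), op b (op a x y) z = op a (op b x z) y

/-- The product `x ▷_a y` of a multi-Novikov algebra over `K`. -/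
def novikovOp (K : Type*) {A N : Type*} [CommRing K] [AddCommGroup N] [Module K N]
    [MultiNovikovAlgebra K A N] (a : A) (x y : N) : N :=
  MultiNovikovAlgebra.op (K := K) a x y

/-- A multi-Novikov subalgebra: a `K`-submodule closed under all the products `▷_a`. -/
structure MultiNovikovSubalgebra (K A N : Type*) [CommRing K] [AddCommGroup N] [Module K N]
    [MultiNovikovAlgebra K A N] where
  /-- the underlying submodule -/
  toSubmodule : Submodule K N
  op_mem : ∀ (a : A) {x y : N}, x ∈ toSubmodule → y ∈ toSubmodule →
    novikovOp K a x y ∈ toSubmodule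

namespace MultiNovikovSubalgebra

/-- The multi-Novikov subalgebra generated by a subset `s`: the intersection of all the multi-Novikov
subalgebras that contain `s`. -/
def adjoin (K A : Type*) {N : Type*} [CommRing K] [AddCommGroup N] [Module K N]
    [MultiNovikovAlgebra K A N] (s : Set N) : MultiNovikovSubalgebra K A N where
  toSubmodule := sInf {p | ∃ S : MultiNovikovSubalgebra K A N, S.toSubmodule = p ∧ s ⊆ (p : Set N)}
  op_mem := by
    intro a x y hx hy
    rw [Submodule.mem_sInf] at hx hy ⊢
    rintro p ⟨S, rfl, hs⟩
    exact S.op_mem a (hx _ ⟨S, rfl, hs⟩) (hy _ ⟨S, rfl, hs⟩)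

/-- A multi-Novikov subalgebra is a multi-Novikov algebra for the restricted products. -/
instance instMultiNovikovAlgebra {K A N : Type*} [CommRing K] [AddCommGroup N] [Module K N]
    [MultiNovikovAlgebra K A N] (S : MultiNovikovSubalgebra K A N) :
    MultiNovikovAlgebra K A S.toSubmodule where
  op a := LinearMap.mk₂ K
    (fun x y => (⟨novikovOp K a x.1 y.1, S.op_mem a x.2 y.2⟩ : S.toSubmodule))
    (fun _ _ _ => Subtype.ext (by simp [novikovOp]))
    (fun _ _ _ => Subtype.ext (by simp [novikovOp]))
    (fun _ _ _ => Subtype.ext (by simp [novikovOp]))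
    (fun _ _ _ => Subtype.ext (by simp [novikovOp]))
  op_exchange_left a b x y z := Subtype.ext
    (MultiNovikovAlgebra.op_exchange_left (K := K) a b x.1 y.1 z.1)
  op_exchange_index a b x y z := Subtype.ext
    (MultiNovikovAlgebra.op_exchange_index (K := K) a b x.1 y.1 z.1)
  op_right_comm a b x y z := Subtype.ext
    (MultiNovikovAlgebra.op_right_comm (K := K) a b x.1 y.1 z.1)

end MultiNovikovSubalgebra

/-- A commutative multidifferential algebra: a commutative associative `K`-algebra `R` with pairwise
commuting `K`-linear derivations `∂_a`, `a ∈ A`. -/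
class CommMultiDiffAlgebra (K A R : Type*) [CommRing K] [CommRing R] [Algebra K R] where
  /-- the derivation `∂_a` -/
  der : A → Derivation K R R
  der_comm : ∀ (a b : A) (r : R), der a (der b r) = der b (der a r)

/-- The derivation `∂_a` of a commutative multidifferential algebra over `K`. -/
def multiDer (K : Type*) {A R : Type*} [CommRing K] [CommRing R] [Algebra K R]
    [CommMultiDiffAlgebra K A R] (a : A) : Derivation K R R :=
  CommMultiDiffAlgebra.der (K := K) a

/-- The canonical multi-Novikov structure `x ▷_a y = x ∂_a(y)` of a commutative multidifferential
algebra. -/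
instance canonicalMultiNovikov {K A R : Type*} [CommRing K] [CommRing R] [Algebra K R]
    [CommMultiDiffAlgebra K A R] : MultiNovikovAlgebra K A R where
  op a := LinearMap.mk₂ K (fun x y => x * multiDer K a y)
    (fun _ _ _ => add_mul _ _ _)
    (fun _ _ _ => by simp)
    (fun _ _ _ => by simp [mul_add])
    (fun _ _ _ => by simp)
  op_exchange_left a b x y z := by simp; ring
  op_exchange_index a b x y z := by
    have h : multiDer K a (multiDer K b z) = multiDer K b (multiDer K a z) :=
      CommMultiDiffAlgebra.der_comm a b z
    simp [h]; ring
  op_right_comm a b x y z := by simp; ring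

/-- The free commutative multidifferential algebra on `X`: the polynomial algebra over `K` in the
variables `(x, m)`, `x ∈ X`, `m : A → ℕ` finitely supported, where `(x, m)` stands for
`∏_a ∂_a^{m(a)} (x)`. -/
abbrev CDi (K A X : Type*) [CommRing K] : Type _ := MvPolynomial (X × (A →₀ ℕ)) K

namespace CDi

/-- The derivation `∂_a` of the polynomial algebra with `∂_a (x, m) = (x, m + δ_a)`. -/
def der (K : Type*) {A : Type*} (X : Type*) [CommRing K] (a : A) :
    Derivation K (CDi K A X) (CDi K A X) :=
  MvPolynomial.mkDerivation K fun v => MvPolynomial.X (v.1, v.2 + Finsupp.single a 1)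

theorem der_comm (K : Type*) {A : Type*} (X : Type*) [CommRing K] (a b : A) (p : CDi K A X) :
    der K X a (der K X b p) = der K X b (der K X a p) := by
  have h : ⁅der K X a, der K X b⁆ = 0 := by
    apply MvPolynomial.derivation_ext
    intro v
    simp [der, Derivation.commutator_apply, add_right_comm]
  have h' := congrArg (fun D => D p) h
  simpa [Derivation.commutator_apply, sub_eq_zero] using h'

instance instCommMultiDiffAlgebra (K A X : Type*) [CommRing K] :
    CommMultiDiffAlgebra K A (CDi K A X) where
  der := der K X
  der_comm := der_comm K X

/-- The generator `x = (x, 0)`. -/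
def of (K A : Type*) {X : Type*} [CommRing K] (x : X) : CDi K A X := MvPolynomial.X (x, 0)

/-- The universal property of the free commutative multidifferential algebra on `X`. -/
theorem existsUnique_lift {K A X R : Type*} [CommRing K] [CommRing R] [Algebra K R]
    [CommMultiDiffAlgebra K A R] (f : X → R) :
    ∃! φ : CDi K A X →ₐ[K] R,
      (∀ (a : A) (p : CDi K A X), φ (multiDer K a p) = multiDer K a (φ p)) ∧
        ∀ x, φ (of K A x) = f x := by
  classical
  have : LeftCommutative (fun (a : A) (r : R) => multiDer K a r) :=
    ⟨fun a b r => CommMultiDiffAlgebra.der_comm a b r⟩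
  have hX : ∀ (a : A) (x : X) (m : A →₀ ℕ), multiDer K a (MvPolynomial.X (x, m) : CDi K A X) =
      MvPolynomial.X (x, m + Finsupp.single a 1) := fun a x m =>
    MvPolynomial.mkDerivation_X _ _ _
  refine ⟨MvPolynomial.aeval fun v : X × (A →₀ ℕ) =>
    (Finsupp.toMultiset v.2).foldr (fun (a : A) (r : R) => multiDer K a r) (f v.1),
    ⟨?_, ?_⟩, ?_⟩
  · intro a p
    induction p using MvPolynomial.induction_on with
    | C k => simp [MvPolynomial.algHom_C, ← MvPolynomial.algebraMap_eq]
    | add p q hp hq => simp only [map_add, hp, hq]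
    | mul_X p v hp =>
      obtain ⟨x, m⟩ := v
      rw [Derivation.leibniz, map_add, smul_eq_mul, smul_eq_mul, map_mul, map_mul, map_mul,
        Derivation.leibniz, hp, hX]
      simp only [MvPolynomial.aeval_X, map_add, Finsupp.toMultiset_single, one_smul, smul_eq_mul]
      rw [add_comm (Finsupp.toMultiset m), Multiset.singleton_add, Multiset.foldr_cons]
  · intro x
    simp [of]
  · rintro ψ ⟨hψ, hψf⟩
    apply MvPolynomial.algHom_ext
    rintro ⟨x, m⟩
    obtain ⟨s, rfl⟩ := Multiset.toFinsupp.surjective m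
    simp only [MvPolynomial.aeval_X, Multiset.toFinsupp_toMultiset]
    induction s using Multiset.induction_on with
    | empty => simpa [of] using hψf x
    | cons a s ih =>
      rw [Multiset.foldr_cons, ← ih, ← hψ, hX, ← Multiset.singleton_add, map_add, add_comm,
        Multiset.toFinsupp_singleton]

end CDi

/-- Multi-magmatic monomials: planar binary trees with internal vertices labelled by `A` and leaves
labelled by `X`. -/
inductive MagTree (A X : Type*) : Type _
  /-- a generator -/
  | of : X → MagTree A X
  /-- the monomial `s ▷_a t` -/
  | node : A → MagTree A X → MagTree A X → MagTree A X

/-- The multi-magmatic algebra: the free `K`-module on the multi-magmatic monomials. -/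
abbrev Mag (K A X : Type*) [CommRing K] : Type _ := MagTree A X →₀ K

namespace Mag

/-- The bilinear product `▷_a` that extends `(s, t) ↦ s ▷_a t` on monomials. -/
def op (K : Type*) {A X : Type*} [CommRing K] (a : A) :
    Mag K A X →ₗ[K] Mag K A X →ₗ[K] Mag K A X :=
  Finsupp.linearCombination K fun s => Finsupp.lmapDomain K K (MagTree.node a s)

/-- The two-sided ideals of the multi-magmatic algebra. -/
def IsIdeal {K A X : Type*} [CommRing K] (J : Submodule K (Mag K A X)) : Prop :=
  ∀ (a : A) (u v : Mag K A X), (u ∈ J → op K a u v ∈ J) ∧ (v ∈ J → op K a u v ∈ J)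

/-- `J` contains all the instances of the multi-Novikov identities. -/
def ContainsNovikov {K A X : Type*} [CommRing K] (J : Submodule K (Mag K A X)) : Prop :=
  ∀ (a b : A) (x y z : Mag K A X),
    ((op K b (op K a x y) z - op K a x (op K b y z))
        - (op K b (op K a y x) z - op K a y (op K b x z)) ∈ J) ∧
    ((op K b (op K a x y) z - op K a x (op K b y z))
        - (op K a (op K b x y) z - op K b x (op K a y z)) ∈ J) ∧
    (op K b (op K a x y) z - op K a (op K b x z) y ∈ J)

/-- The ideal generated by the multi-Novikov identities. -/
def novikovIdeal (K A X : Type*) [CommRing K] : Submodule K (Mag K A X) :=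
  sInf {J | IsIdeal J ∧ ContainsNovikov J}

theorem novikovIdeal_isIdeal (K A X : Type*) [CommRing K] : IsIdeal (novikovIdeal K A X) := by
  intro a u v
  simp only [novikovIdeal, Submodule.mem_sInf]
  exact ⟨fun h J hJ => (hJ.1 a u v).1 (h J hJ), fun h J hJ => (hJ.1 a u v).2 (h J hJ)⟩

theorem novikovIdeal_containsNovikov (K A X : Type*) [CommRing K] :
    ContainsNovikov (novikovIdeal K A X) := by
  intro a b x y z
  simp only [novikovIdeal, Submodule.mem_sInf]
  exact ⟨fun J hJ => (hJ.2 a b x y z).1, fun J hJ => (hJ.2 a b x y z).2.1,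
    fun J hJ => (hJ.2 a b x y z).2.2⟩

end Mag

/-- The free multi-Novikov algebra on `X`: the quotient of the multi-magmatic algebra by the ideal
generated by the multi-Novikov identities. -/
abbrev Nov (K A X : Type*) [CommRing K] : Type _ := Mag K A X ⧸ Mag.novikovIdeal K A X

namespace Nov

/-- The generator `x`. -/
def of (K A : Type*) {X : Type*} [CommRing K] (x : X) : Nov K A X :=
  (Mag.novikovIdeal K A X).mkQ (Finsupp.single (MagTree.of x) 1)

/-- The product `▷_a` induced on the quotient. -/
def op (K : Type*) {A : Type*} (X : Type*) [CommRing K] (a : A) :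
    Nov K A X →ₗ[K] Nov K A X →ₗ[K] Nov K A X :=
  (Mag.novikovIdeal K A X).liftQ
    (LinearMap.flip ((Mag.novikovIdeal K A X).liftQ
      (LinearMap.flip ((Mag.op K a).compr₂ (Mag.novikovIdeal K A X).mkQ))
      (fun v hv => by
        rw [LinearMap.mem_ker]
        refine LinearMap.ext fun u => ?_
        exact (Submodule.Quotient.mk_eq_zero _).2
          ((Mag.novikovIdeal_isIdeal K A X a _ v).2 hv))))
    (fun u hu => by
      rw [LinearMap.mem_ker]
      refine LinearMap.ext fun v => ?_
      obtain ⟨v, rfl⟩ := Submodule.mkQ_surjective _ v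
      exact (Submodule.Quotient.mk_eq_zero _).2
        ((Mag.novikovIdeal_isIdeal K A X a u v).1 hu))

theorem op_mkQ (K : Type*) {A X : Type*} [CommRing K] (a : A) (u v : Mag K A X) :
    op K X a ((Mag.novikovIdeal K A X).mkQ u) ((Mag.novikovIdeal K A X).mkQ v) =
      (Mag.novikovIdeal K A X).mkQ (Mag.op K a u v) := rfl

instance instMultiNovikovAlgebra (K A X : Type*) [CommRing K] :
    MultiNovikovAlgebra K A (Nov K A X) where
  op := op K X
  op_exchange_left a b x y z := by
    obtain ⟨x, rfl⟩ := Submodule.mkQ_surjective _ x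
    obtain ⟨y, rfl⟩ := Submodule.mkQ_surjective _ y
    obtain ⟨z, rfl⟩ := Submodule.mkQ_surjective _ z
    simp only [op_mkQ, ← map_sub]
    exact (Submodule.Quotient.eq _).2 (Mag.novikovIdeal_containsNovikov K A X a b x y z).1
  op_exchange_index a b x y z := by
    obtain ⟨x, rfl⟩ := Submodule.mkQ_surjective _ x
    obtain ⟨y, rfl⟩ := Submodule.mkQ_surjective _ y
    obtain ⟨z, rfl⟩ := Submodule.mkQ_surjective _ z
    simp only [op_mkQ, ← map_sub]
    exact (Submodule.Quotient.eq _).2 (Mag.novikovIdeal_containsNovikov K A X a b x y z).2.1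
  op_right_comm a b x y z := by
    obtain ⟨x, rfl⟩ := Submodule.mkQ_surjective _ x
    obtain ⟨y, rfl⟩ := Submodule.mkQ_surjective _ y
    obtain ⟨z, rfl⟩ := Submodule.mkQ_surjective _ z
    simp only [op_mkQ]
    exact (Submodule.Quotient.eq _).2 (Mag.novikovIdeal_containsNovikov K A X a b x y z).2.2

/-- The value of a multi-magmatic monomial in a multi-Novikov algebra. -/
def evalTree (K : Type*) {A X N : Type*} [CommRing K] [AddCommGroup N] [Module K N]
    [MultiNovikovAlgebra K A N] (f : X → N) : MagTree A X → N
  | .of x => f x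
  | .node a s t => novikovOp K a (evalTree K f s) (evalTree K f t)

/-- The universal property of the free multi-Novikov algebra on `X`. -/
theorem existsUnique_lift {K A X N : Type*} [CommRing K] [AddCommGroup N] [Module K N]
    [MultiNovikovAlgebra K A N] (f : X → N) :
    ∃! φ : Nov K A X →ₗ[K] N,
      (∀ (a : A) (u v : Nov K A X), φ (novikovOp K a u v) = novikovOp K a (φ u) (φ v)) ∧
        ∀ x, φ (of K A x) = f x := by
  let g : Mag K A X →ₗ[K] N := Finsupp.linearCombination K (evalTree K f)
  have hg : ∀ (a : A) (u v : Mag K A X), g (Mag.op K a u v) = novikovOp K a (g u) (g v) := by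
    intro a u v
    have : (Mag.op K a).compr₂ g = (MultiNovikovAlgebra.op (K := K) a).compl₁₂ g g := by
      ext s t
      simp [g, Mag.op, evalTree, novikovOp]
    exact LinearMap.congr_fun₂ this u v
  have hker : Mag.novikovIdeal K A X ≤ LinearMap.ker g := by
    apply sInf_le
    refine ⟨fun a u v => ⟨fun hu => ?_, fun hv => ?_⟩, fun a b x y z => ⟨?_, ?_, ?_⟩⟩
    · rw [LinearMap.mem_ker] at hu ⊢
      rw [hg, hu]; simp [novikovOp]
    · rw [LinearMap.mem_ker] at hv ⊢
      rw [hg, hv]; simp [novikovOp]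
    · rw [LinearMap.mem_ker, map_sub, sub_eq_zero, map_sub, map_sub]
      simp only [hg]
      exact MultiNovikovAlgebra.op_exchange_left a b _ _ _
    · rw [LinearMap.mem_ker, map_sub, sub_eq_zero, map_sub, map_sub]
      simp only [hg]
      exact MultiNovikovAlgebra.op_exchange_index a b _ _ _
    · rw [LinearMap.mem_ker, map_sub, sub_eq_zero]
      simp only [hg]
      exact MultiNovikovAlgebra.op_right_comm a b _ _ _
  refine ⟨(Mag.novikovIdeal K A X).liftQ g hker, ⟨?_, ?_⟩, ?_⟩
  · intro a u v
    obtain ⟨u, rfl⟩ := Submodule.mkQ_surjective _ u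
    obtain ⟨v, rfl⟩ := Submodule.mkQ_surjective _ v
    exact hg a u v
  · intro x
    simp [of, g, evalTree]
  · rintro ψ ⟨hψ, hψf⟩
    ext t
    simp only [LinearMap.coe_comp, Function.comp_apply, Finsupp.lsingle_apply,
      Submodule.liftQ_mkQ]
    simp only [g, Finsupp.linearCombination_single, one_smul]
    induction t with
    | of x => exact hψf x
    | node a s t hs ht =>
      have h := hψ a ((Mag.novikovIdeal K A X).mkQ (Finsupp.single s 1))
        ((Mag.novikovIdeal K A X).mkQ (Finsupp.single t 1))
      rw [hs, ht] at h
      rw [evalTree, ← h]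
      congr 1
      change _ = (Mag.novikovIdeal K A X).mkQ (Mag.op K a _ _)
      simp [Mag.op]

end Nov

end

/-! The universal property of `Nov` gives a map φ to `CDi` whose image is generated by `X`; the
content is injectivity. Products built by u ∂_a(v) involve only balanced differential monomials,
those with one more factor than derivatives. It is shown that in any multi-Novikov algebra `N` each
balanced monomial has a well-defined representative (`monomialEval`, `monomialEval_perm`), that the
representatives in given generators span a subalgebra (`monomialSpan`), hence all of `Nov`, and that
φ sends each to the monomial it represents (`map_monomialEval_of`). Distinct monomials are linearly
independent, so φ is injective.

`N` has no product, but it has multiplication operators. The right multiplications R_{a,z}, which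
stand for multiplication by ∂_a z, commute by the third identity and generate a commutative algebra
E. By the first identity, the commutator with left multiplication by x, which stands for x∂_a,
preserves E and is a derivation D_{a,x} (`leftDer`). Since ∂_a alone upsets the balance, ∂^m y is
encoded as the function s ↦ (∏ s) ∂^m y with values in E, and a symbol h is differentiated by (x ∏
s) ∂_a h = D_{a,x}(h(s)) - Σ_{z ∈ s} R_{a,z} h(x, s∖z). The exchange identities make this
independent of the choice of x (`symbolDer_cons`) and make the derivatives commute
(`symbolDer_comm`). A representative is obtained by letting symbols act successively on one last
undifferentiated factor; `smul_monomialEval_swap` shows that the distribution of the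
undifferentiated factors is immaterial. -/

noncomputable section

namespace MultiNovikovAlgebra

/-! ### The commutative algebra of right multiplications and its derivations -/

section Operators

variable (K A N : Type*) [CommRing K] [AddCommGroup N] [Module K N] [MultiNovikovAlgebra K A N]

/-- The algebra of operators generated by the right multiplications `x ↦ x ▷_a z`. -/
def RightMulAlgebra : Type _ :=
  Algebra.adjoin K (Set.range fun p : A × N => (op (K := K) p.1).flip p.2)

namespace RightMulAlgebra

instance instCommRing : CommRing (RightMulAlgebra K A N) where
  __ : Ring (RightMulAlgebra K A N) := inferInstanceAs (Ring (Algebra.adjoin K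
    (Set.range fun p : A × N => (op (K := K) p.1).flip p.2)))
  mul_comm := (Algebra.isMulCommutative_adjoin K (by
    rintro _ ⟨⟨a, y⟩, rfl⟩ _ ⟨⟨b, z⟩, rfl⟩
    refine LinearMap.ext fun x => ?_
    exact op_right_comm b a x z y)).is_comm.comm

/-- The inclusion into the algebra of endomorphisms. -/
def toEnd : RightMulAlgebra K A N →+* Module.End K N :=
  (Algebra.adjoin K (Set.range fun p : A × N => (op (K := K) p.1).flip p.2)).val.toRingHom

instance instAlgebra : Algebra K (RightMulAlgebra K A N) :=
  RingHom.toAlgebra (algebraMap K (Algebra.adjoin K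
    (Set.range fun p : A × N => (op (K := K) p.1).flip p.2)))

instance instModule : Module (RightMulAlgebra K A N) N := Module.compHom N (toEnd K A N)

instance instIsScalarTower : IsScalarTower K (RightMulAlgebra K A N) N where
  smul_assoc c e u := by
    rw [Algebra.smul_def, mul_smul]
    rfl

end RightMulAlgebra

variable {N}

/-- Right multiplication by `z` for the product `▷_a`. -/
def rightMul (a : A) : N →ₗ[K] RightMulAlgebra K A N where
  toFun z := ⟨(op (K := K) a).flip z, Algebra.subset_adjoin ⟨(a, z), rfl⟩⟩
  map_add' y z := Subtype.ext (map_add (op (K := K) a).flip y z)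
  map_smul' c z := (Subtype.ext (map_smul (op (K := K) a).flip c z) :
    (⟨_, _⟩ : Algebra.adjoin K (Set.range fun p : A × N => (op (K := K) p.1).flip p.2)) =
      c • ⟨_, _⟩).trans (Algebra.smul_def _ _)

variable {K A}

theorem rightMul_smul (a : A) (x z : N) : rightMul K A a z • x = novikovOp K a x z := rfl

theorem RightMulAlgebra.ext {e f : RightMulAlgebra K A N} (h : ∀ u : N, e • u = f • u) : e = f :=
  Subtype.ext (LinearMap.ext h)

theorem RightMulAlgebra.induction {p : RightMulAlgebra K A N → Prop}
    (hR : ∀ a z, p (rightMul K A a z)) (hC : ∀ c : K, p (algebraMap K _ c))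
    (hadd : ∀ e f, p e → p f → p (e + f)) (hmul : ∀ e f, p e → p f → p (e * f))
    (e : RightMulAlgebra K A N) : p e := by
  obtain ⟨e, he⟩ := e
  induction he using Algebra.adjoin_induction with
  | mem x hx => obtain ⟨⟨a, z⟩, rfl⟩ := hx; exact hR a z
  | algebraMap c => exact hC c
  | add x y hx hy ihx ihy => exact hadd _ _ ihx ihy
  | mul x y hx hy ihx ihy => exact hmul _ _ ihx ihy

theorem op_smul_rightMul (a b : A) (x u z : N) :
    novikovOp K a x (rightMul K A b z • u) - rightMul K A b z • novikovOp K a x u =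
      rightMul K A a (novikovOp K b x z) • u - (rightMul K A b z * rightMul K A a x) • u := by
  have h := op_exchange_left (K := K) a b x u z
  rw [mul_smul]
  simp only [rightMul_smul, novikovOp] at h ⊢
  linear_combination (norm := module) -h

/-- Commutators obey the Leibniz rule, so it suffices to treat the generators, where
`op_smul_rightMul` gives the commutator explicitly. As E acts faithfully, the operator found is
unique, which is what makes a choice of it linear and a derivation. -/
theorem exists_commutator (a : A) (x : N) (e : RightMulAlgebra K A N) :
    ∃ f : RightMulAlgebra K A N, ∀ u : N,
      f • u = novikovOp K a x (e • u) - e • novikovOp K a x u := by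
  induction e using RightMulAlgebra.induction with
  | hR b z =>
    refine ⟨rightMul K A a (novikovOp K b x z) - rightMul K A b z * rightMul K A a x, fun u => ?_⟩
    rw [op_smul_rightMul, sub_smul]
  | hC c => exact ⟨0, fun u => by simp [novikovOp]⟩
  | hadd e f he hf =>
    obtain ⟨e', he⟩ := he
    obtain ⟨f', hf⟩ := hf
    refine ⟨e' + f', fun u => ?_⟩
    simp only [add_smul, he, hf, novikovOp, map_add]
    abel
  | hmul e f he hf =>
    obtain ⟨e', he⟩ := he
    obtain ⟨f', hf⟩ := hf
    refine ⟨e' * f + e * f', fun u => ?_⟩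
    simp only [add_smul, mul_smul, he, hf, smul_sub]
    abel

/-- The derivation `e ↦ [L_{a,x}, e]`, where `L_{a,x}` is left multiplication by `x` for `▷_a`. -/
def leftDer (a : A) (x : N) : Derivation K (RightMulAlgebra K A N) (RightMulAlgebra K A N) :=
  have spec := fun e => (exists_commutator (K := K) a x e).choose_spec
  Derivation.mk'
    { toFun := fun e => (exists_commutator a x e).choose
      map_add' := fun e f => RightMulAlgebra.ext fun u => by
        rw [add_smul, spec, spec, spec]
        simp only [add_smul, novikovOp, map_add]
        abel
      map_smul' := fun c e => RightMulAlgebra.ext fun u => by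
        rw [RingHom.id_apply, smul_assoc, spec, spec]
        simp only [smul_assoc, novikovOp, map_smul, smul_sub] }
    (fun e f => RightMulAlgebra.ext fun u => by
      rw [add_smul, smul_eq_mul, smul_eq_mul, mul_comm f, mul_smul, mul_smul]
      refine (spec _ _).trans ((congrArg₂ (fun x y => e • x + y) (spec _ _) (spec _ _)).trans
        ?_).symm
      simp only [mul_smul, smul_sub]
      abel)

theorem leftDer_smul (a : A) (x : N) (e : RightMulAlgebra K A N) (u : N) :
    leftDer a x e • u = novikovOp K a x (e • u) - e • novikovOp K a x u :=
  (exists_commutator a x e).choose_spec u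

theorem leftDer_mul (a : A) (x : N) (e f : RightMulAlgebra K A N) :
    leftDer a x (e * f) = leftDer a x e * f + e * leftDer a x f := by
  rw [Derivation.leibniz, smul_eq_mul, smul_eq_mul]; ring

theorem leftDer_rightMul (a b : A) (x z : N) :
    leftDer a x (rightMul K A b z) =
      rightMul K A a (novikovOp K b x z) - rightMul K A b z * rightMul K A a x :=
  RightMulAlgebra.ext fun u => by rw [leftDer_smul, op_smul_rightMul, sub_smul]

theorem leftDer_rightMul_comm (a b : A) (x z : N) :
    leftDer a x (rightMul K A b z) = leftDer b x (rightMul K A a z) :=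
  RightMulAlgebra.ext fun u => by
    have h := op_exchange_index (K := K) a b x u z
    simp only [leftDer_smul, rightMul_smul, novikovOp] at h ⊢
    linear_combination (norm := module) -h

/-- Both sides stand for x u ∂_a e. On generators this is the first identity; products reduce to
their factors by commutativity of E. -/
theorem leftDer_smul_comm (a : A) (x u : N) (e : RightMulAlgebra K A N) :
    leftDer a x e • u = leftDer a u e • x := by
  induction e using RightMulAlgebra.induction generalizing x u with
  | hR b z =>
    have h := op_exchange_left (K := K) a b x u z
    simp only [leftDer_smul, rightMul_smul, novikovOp] at h ⊢
    linear_combination (norm := module) -h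
  | hC c => simp
  | hadd e f he hf => rw [map_add, map_add, add_smul, add_smul, he, hf]
  | hmul e f he hf =>
    rw [leftDer_mul, leftDer_mul, mul_comm _ f, mul_comm _ f, add_smul, add_smul, mul_smul,
      mul_smul, mul_smul, mul_smul, he, hf]

/-- The Leibniz rule for ∂_a(e x). It expresses right multiplication by a compound element through E
and its derivations. -/
theorem rightMul_smul_right (a : A) (e : RightMulAlgebra K A N) (x : N) :
    rightMul K A a (e • x) = e * rightMul K A a x + leftDer a x e := by
  refine RightMulAlgebra.ext fun u => ?_
  rw [add_smul, mul_smul, rightMul_smul, rightMul_smul, leftDer_smul_comm, leftDer_smul]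
  abel

/-- Applied to u, the product has x, y and u as interchangeable arguments; three transpositions
exchange x and y. -/
theorem mul_comm_of_smul_comm {f g : N → RightMulAlgebra K A N}
    (hf : ∀ x u, f x • u = f u • x) (hg : ∀ x u, g x • u = g u • x) (x y : N) :
    f x * g y = f y * g x :=
  RightMulAlgebra.ext fun u => by
    rw [mul_smul, hg y u, ← mul_smul, mul_comm, mul_smul, hf x y, ← mul_smul, mul_comm, mul_smul,
      hg u x, mul_smul]

/-- Each side stands for x y ∂_a ∂_b e. The Leibniz rule computes ∂_a of one element of `N`, written
both as (D_{b,y} e) x and as (D_{b,x} e) y. -/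
theorem leftDer_leftDer_comm_left (a b : A) (x y : N) (e : RightMulAlgebra K A N) :
    leftDer a x (leftDer b y e) - rightMul K A a y * leftDer b x e =
      leftDer a y (leftDer b x e) - rightMul K A a x * leftDer b y e := by
  have h1 := rightMul_smul_right a (leftDer b y e) x
  have h2 := rightMul_smul_right a (leftDer b x e) y
  rw [leftDer_smul_comm] at h1
  linear_combination h2 - h1

theorem leftDer_leftDer_comm_index (a b : A) (x y : N) (e : RightMulAlgebra K A N) :
    leftDer a x (leftDer b y e) - rightMul K A a y * leftDer b x e =
      leftDer b x (leftDer a y e) - rightMul K A b y * leftDer a x e := by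
  induction e using RightMulAlgebra.induction with
  | hR c z =>
    -- The index c is moved to the outer derivation, which leaves a and b only in terms D_{a,·}
    -- R_{b,z}; these are symmetric in a and b.
    have key : ∀ a b : A, leftDer a x (leftDer b y (rightMul K A c z)) -
        rightMul K A a y * leftDer b x (rightMul K A c z) =
        leftDer c x (leftDer a y (rightMul K A b z)) -
        leftDer a x (rightMul K A b z) * rightMul K A c y := by
      intro a b
      have h : rightMul K A a (novikovOp K b y z) =
          rightMul K A b z * rightMul K A a y + leftDer a y (rightMul K A b z) :=
        rightMul_smul_right a (rightMul K A b z) y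
      rw [leftDer_rightMul_comm b c y, leftDer_rightMul c b y, map_sub,
        leftDer_rightMul_comm a c x (novikovOp K b y z), h, map_add, leftDer_mul, leftDer_mul,
        leftDer_rightMul_comm b c x z, leftDer_rightMul_comm a c x y]
      ring
    rw [key, key b a, leftDer_rightMul_comm a b y, leftDer_rightMul_comm a b x]
  | hC c => simp
  | hadd e f he hf =>
    simp only [map_add]
    linear_combination he + hf
  | hmul e f he hf =>
    -- The mixed terms of the second-order Leibniz rule match after exchanging x and y.
    have h1 : leftDer a x e * leftDer b y f = leftDer a y e * leftDer b x f :=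
      mul_comm_of_smul_comm (f := fun x => leftDer a x e) (g := fun y => leftDer b y f)
        (fun _ _ => leftDer_smul_comm _ _ _ _) (fun _ _ => leftDer_smul_comm _ _ _ _) x y
    have h2 : leftDer b x e * leftDer a y f = leftDer b y e * leftDer a x f :=
      mul_comm_of_smul_comm (f := fun x => leftDer b x e) (g := fun y => leftDer a y f)
        (fun _ _ => leftDer_smul_comm _ _ _ _) (fun _ _ => leftDer_smul_comm _ _ _ _) x y
    simp only [leftDer_mul, map_add]
    linear_combination f * he + e * hf + h1 - h2

end Operators

end MultiNovikovAlgebra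
end
noncomputable section

namespace MultiNovikovAlgebra

/-! ### Formal symbols and their commuting derivatives -/

section Symbols

open scoped Classical

variable {K A N : Type*} [CommRing K] [AddCommGroup N] [Module K N] [MultiNovikovAlgebra K A N]

/-- Each side is the full double sum minus its diagonal. -/
theorem _root_.Multiset.sum_map_sum_map_erase_comm {α M : Type*} [AddCommGroup M] (s : Multiset α)
    (F : α → α → M) :
    (s.map fun z => ((s.erase z).map fun w => F z w).sum).sum =
      (s.map fun z => ((s.erase z).map fun w => F w z).sum).sum := by
  have key : ∀ F : α → α → M, (s.map fun z => ((s.erase z).map fun w => F z w).sum).sum =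
      (s.map fun z => (s.map fun w => F z w).sum).sum - (s.map fun z => F z z).sum := by
    intro F
    rw [← Multiset.sum_map_sub]
    refine congrArg _ (Multiset.map_congr rfl fun z hz => ?_)
    rw [← Multiset.sum_map_erase (f := fun w => F z w) hz]
    abel
  rw [key, key, Multiset.sum_map_sum_map]

/-- The value at `x ::ₘ s` of the derivative `∂_a h` of a function `h` on multisets, thought of as
the function `s ↦ (∏ s) h` of a formal symbol `h`. -/
def symbolDerAux (a : A) (h : Multiset N → RightMulAlgebra K A N) (x : N) (s : Multiset N) :
    RightMulAlgebra K A N :=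
  leftDer a x (h s) - (s.map fun z => rightMul K A a z * h (x ::ₘ s.erase z)).sum

/-- The derivative `∂_a h` of a function `h` on multisets, thought of as the function
`s ↦ (∏ s) h` of a formal symbol `h`. -/
def symbolDer (a : A) (h : Multiset N → RightMulAlgebra K A N) (s : Multiset N) :
    RightMulAlgebra K A N :=
  if hs : ∃ x, x ∈ s then symbolDerAux a h hs.choose (s.erase hs.choose) else 0

/-- The compatibility conditions under which `h` has well-behaved derivatives. -/
structure IsSymbol (h : Multiset N → RightMulAlgebra K A N) : Prop where
  smul_comm : ∀ x u s, h (x ::ₘ s) • u = h (u ::ₘ s) • x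
  der_comm : ∀ (a : A) x y s, leftDer a x (h (y ::ₘ s)) - rightMul K A a y * h (x ::ₘ s) =
    leftDer a y (h (x ::ₘ s)) - rightMul K A a x * h (y ::ₘ s)

/-- Isolating the summand for y leaves x y ∂_a((∏ s) h), symmetric in x and y by
`IsSymbol.der_comm`, and a sum that is visibly symmetric. -/
theorem symbolDerAux_cons (a : A) (h : Multiset N → RightMulAlgebra K A N) (x y : N)
    (s : Multiset N) : symbolDerAux a h x (y ::ₘ s) =
      leftDer a x (h (y ::ₘ s)) - rightMul K A a y * h (x ::ₘ s) -
        (s.map fun z => rightMul K A a z * h (x ::ₘ y ::ₘ s.erase z)).sum := by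
  rw [symbolDerAux, Multiset.map_cons, Multiset.sum_cons, Multiset.erase_cons_head, ← sub_sub]
  congr 2
  refine Multiset.map_congr rfl fun z hz => ?_
  rw [Multiset.erase_cons_tail_of_mem hz]

theorem symbolDer_zero (a : A) (h : Multiset N → RightMulAlgebra K A N) :
    symbolDer a h 0 = 0 := by
  simp [symbolDer]

theorem symbolDer_singleton (a : A) (h : Multiset N → RightMulAlgebra K A N) (x : N) :
    symbolDer a h {x} = leftDer a x (h 0) := by
  have hs : ∃ y, y ∈ ({x} : Multiset N) := ⟨x, by simp⟩
  have hx : hs.choose = x := Multiset.mem_singleton.1 hs.choose_spec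
  rw [symbolDer, dif_pos hs, hx]
  simp [symbolDerAux]

/-- The symbol of the operator of multiplication by `∂_a y`. -/
def rightMulSymbol (a : A) (y : N) (s : Multiset N) : RightMulAlgebra K A N :=
  if s = 0 then rightMul K A a y else 0

theorem isSymbol_rightMulSymbol (a : A) (y : N) :
    IsSymbol (rightMulSymbol (K := K) a y) where
  smul_comm x u s := by simp [rightMulSymbol]
  der_comm b x z s := by simp [rightMulSymbol]

namespace IsSymbol

variable {h : Multiset N → RightMulAlgebra K A N}

theorem symbolDer_cons (hh : IsSymbol h) (a : A) (x : N) (s : Multiset N) :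
    symbolDer a h (x ::ₘ s) = symbolDerAux a h x s := by
  have hs : ∃ y, y ∈ x ::ₘ s := ⟨x, Multiset.mem_cons_self x s⟩
  rw [symbolDer, dif_pos hs]
  have hy := hs.choose_spec
  generalize hs.choose = y at hy
  rcases Multiset.mem_cons.1 hy with rfl | hy
  · rw [Multiset.erase_cons_head]
  · obtain ⟨t, rfl⟩ := Multiset.exists_cons_of_mem hy
    rw [Multiset.cons_swap, Multiset.erase_cons_head, symbolDerAux_cons, symbolDerAux_cons,
      hh.der_comm]
    simp only [Multiset.cons_swap x y]

theorem symbolDer_cons_eq (hh : IsSymbol h) (a : A) (x : N) (s : Multiset N) :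
    symbolDer a h (x ::ₘ s) =
      leftDer a x (h s) - (s.map fun z => rightMul K A a z * h (x ::ₘ s.erase z)).sum :=
  hh.symbolDer_cons a x s

theorem symbolDer_cons_cons (hh : IsSymbol h) (a : A) (x y : N) (s : Multiset N) :
    symbolDer a h (x ::ₘ y ::ₘ s) =
      leftDer a x (h (y ::ₘ s)) - rightMul K A a y * h (x ::ₘ s) -
        (s.map fun z => rightMul K A a z * h (x ::ₘ y ::ₘ s.erase z)).sum := by
  rw [hh.symbolDer_cons, symbolDerAux_cons]

theorem mul_comm (hh : IsSymbol h) {g : N → RightMulAlgebra K A N}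
    (hg : ∀ x u, g x • u = g u • x) (x y : N) (s : Multiset N) :
    g x * h (y ::ₘ s) = g y * h (x ::ₘ s) :=
  mul_comm_of_smul_comm (g := fun y => h (y ::ₘ s)) hg (fun _ _ => hh.smul_comm _ _ _) x y

theorem leftDer_mul_comm (hh : IsSymbol h) (a : A) (e : RightMulAlgebra K A N) (x y : N)
    (s : Multiset N) : leftDer a x e * h (y ::ₘ s) = leftDer a y e * h (x ::ₘ s) :=
  hh.mul_comm (g := fun x => leftDer a x e) (fun _ _ => leftDer_smul_comm _ _ _ _) x y s

/-- An expansion of x y ∂_a((∏ s) ∂_b h) whose three groups are each symmetric in x and y, and whose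
first group is also symmetric in a and b. -/
theorem der_symbolDer (hh : IsSymbol h) (a b : A) (x y : N) (s : Multiset N) :
    leftDer a x (symbolDer b h (y ::ₘ s)) - rightMul K A a y * symbolDer b h (x ::ₘ s) =
      (leftDer a x (leftDer b y (h s)) - rightMul K A a y * leftDer b x (h s)) -
      (s.map fun z => leftDer a x (rightMul K A b z) * h (y ::ₘ s.erase z)).sum -
      (s.map fun z => rightMul K A b z * (leftDer a x (h (y ::ₘ s.erase z)) -
        rightMul K A a y * h (x ::ₘ s.erase z))).sum := by
  rw [hh.symbolDer_cons_eq, hh.symbolDer_cons_eq, map_sub, map_multiset_sum, Multiset.map_map]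
  simp only [Function.comp_def, leftDer_mul, mul_sub, Multiset.sum_map_sub, Multiset.sum_map_add,
    mul_left_comm (rightMul K A b _) (rightMul K A a y), Multiset.sum_map_mul_left]
  ring

theorem symbolDer (hh : IsSymbol h) (a : A) : IsSymbol (symbolDer a h) where
  smul_comm x u s := by
    rw [hh.symbolDer_cons_eq, hh.symbolDer_cons_eq, sub_smul, sub_smul, leftDer_smul_comm,
      Multiset.sum_smul, Multiset.sum_smul, Multiset.map_map, Multiset.map_map]
    congr 3
    funext z
    simp only [Function.comp_def, mul_smul, hh.smul_comm x u]
  der_comm b x y s := by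
    rw [hh.der_symbolDer, hh.der_symbolDer, leftDer_leftDer_comm_left]
    simp only [hh.leftDer_mul_comm b _ x y, hh.der_comm b x y]

theorem symbolDer_comm (hh : IsSymbol h) (a b : A) :
    MultiNovikovAlgebra.symbolDer a (MultiNovikovAlgebra.symbolDer b h) =
      MultiNovikovAlgebra.symbolDer b (MultiNovikovAlgebra.symbolDer a h) := by
  funext s
  induction s using Multiset.induction_on with
  | empty => rw [symbolDer_zero, symbolDer_zero]
  | cons x s _ =>
    induction s using Multiset.induction_on with
    -- On a one-element multiset both second derivatives vanish, because a derivative is zero at the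
    -- empty multiset.
    | empty =>
      rw [Multiset.cons_zero, symbolDer_singleton, symbolDer_singleton, symbolDer_zero,
        symbolDer_zero, map_zero, map_zero]
    | cons y s _ =>
      rw [(hh.symbolDer b).symbolDer_cons_cons, (hh.symbolDer a).symbolDer_cons_cons,
        hh.der_symbolDer, hh.der_symbolDer, leftDer_leftDer_comm_index a b]
      simp only [leftDer_rightMul_comm a b, hh.symbolDer_cons_cons, mul_sub (rightMul K A _ _)
        (_ - _), Multiset.sum_map_sub, ← Multiset.sum_map_mul_left, ← mul_assoc]
      -- What is not yet symmetric is the double sum of R_{a,z} R_{b,w} h(x, y, s∖{z,w}), where z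
      -- and w must trade roles.
      rw [Multiset.sum_map_sum_map_erase_comm]
      simp only [Multiset.erase_comm, _root_.mul_comm (rightMul K A b _) (rightMul K A a _)]
      ring

end IsSymbol

theorem symbolDer_rightMulSymbol_comm (a b : A) (y : N) :
    symbolDer a (rightMulSymbol (K := K) b y) = symbolDer b (rightMulSymbol a y) := by
  funext s
  induction s using Multiset.induction_on with
  | empty => rw [symbolDer_zero, symbolDer_zero]
  | cons x s _ =>
    rw [(isSymbol_rightMulSymbol b y).symbolDer_cons_eq,
      (isSymbol_rightMulSymbol a y).symbolDer_cons_eq]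
    by_cases hs : s = 0
    · simp [rightMulSymbol, hs, leftDer_rightMul_comm a b]
    · simp [rightMulSymbol, hs]

/-- The symbol of `∂_{a₁} ⋯ ∂_{aₖ} y`. -/
def listSymbol (y : N) : List A → Multiset N → RightMulAlgebra K A N
  | [] => 0
  | a :: l => if l = [] then rightMulSymbol a y else symbolDer a (listSymbol y l)

theorem isSymbol_listSymbol (y : N) (l : List A) : IsSymbol (listSymbol (K := K) y l) := by
  induction l with
  | nil => exact ⟨fun _ _ _ => by simp [listSymbol], fun _ _ _ _ => by simp [listSymbol]⟩
  | cons a l ih =>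
    rw [listSymbol]
    split_ifs
    exacts [isSymbol_rightMulSymbol a y, ih.symbolDer a]

theorem listSymbol_perm (y : N) {l l' : List A} (hl : l.Perm l') :
    listSymbol (K := K) y l = listSymbol y l' := by
  induction hl with
  | nil => rfl
  | cons a hl ih =>
    simp only [listSymbol, ih, ← List.length_eq_zero_iff, hl.length_eq]
  | swap a b l =>
    by_cases hl : l = []
    · simp [listSymbol, hl, symbolDer_rightMulSymbol_comm a b]
    · simp [listSymbol, hl, (isSymbol_listSymbol y l).symbolDer_comm a b]
  | trans _ _ ih ih' => exact ih.trans ih'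

/-- The symbol of `∂^m y`, for `m ≠ 0`: its value at a multiset `s` with `|m| - 1` elements is the
operator of multiplication by `(∏ s) ∂^m y`. -/
def symbol (y : N) (m : A →₀ ℕ) : Multiset N → RightMulAlgebra K A N :=
  listSymbol y (Finsupp.toMultiset m).toList

theorem isSymbol_symbol (y : N) (m : A →₀ ℕ) : IsSymbol (symbol (K := K) y m) :=
  isSymbol_listSymbol y _

theorem symbol_eq_listSymbol (y : N) {m : A →₀ ℕ} {l : List A}
    (hl : Finsupp.toMultiset m = l) : symbol (K := K) y m = listSymbol y l :=
  listSymbol_perm y (Multiset.coe_eq_coe.1 (by rw [Multiset.coe_toList, hl]))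

theorem symbol_single (y : N) (a : A) :
    symbol (K := K) y (Finsupp.single a 1) = rightMulSymbol a y := by
  rw [symbol_eq_listSymbol y (l := [a]) (by simp), listSymbol, if_pos rfl]

theorem symbol_add_single (y : N) {m : A →₀ ℕ} (hm : m ≠ 0) (a : A) :
    symbol (K := K) y (m + Finsupp.single a 1) = symbolDer a (symbol y m) := by
  rw [symbol_eq_listSymbol y (l := a :: (Finsupp.toMultiset m).toList), listSymbol, if_neg, symbol]
  · rw [Multiset.toList_eq_nil]
    exact fun h => hm (by rw [← Finsupp.toMultiset_toFinsupp m, h, Multiset.toFinsupp_zero])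
  · rw [← Multiset.cons_coe, Multiset.coe_toList, map_add, add_comm, Finsupp.toMultiset_single,
      one_smul, Multiset.singleton_add]

end Symbols

end MultiNovikovAlgebra
end
noncomputable section

/-! ### Splittings of multisets -/

theorem Multiset.exists_add_eq_of_le_card {α : Type*} {u : Multiset α} {k : ℕ}
    (hk : k ≤ Multiset.card u) : ∃ s t : Multiset α, u = s + t ∧ Multiset.card s = k := by
  induction u using Quotient.inductionOn with
  | h l =>
    refine ⟨(l.take k : List α), (l.drop k : List α), ?_, ?_⟩
    · simp
    · simpa using hk

/-- Any two splittings of one multiset with the same part sizes are linked by exchanges of single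
elements. -/
theorem Multiset.eq_of_forall_swap {α β : Type*} {Q : Multiset α → Multiset α → β}
    (hQ : ∀ x z s t, Q (x ::ₘ s) (z ::ₘ t) = Q (z ::ₘ s) (x ::ₘ t)) {s t s' t' : Multiset α}
    (h : s + t = s' + t') (hc : Multiset.card s = Multiset.card s') : Q s t = Q s' t' := by
  induction s using Multiset.induction_on generalizing Q s' t' with
  | empty =>
    obtain rfl : s' = 0 := Multiset.card_eq_zero.1 hc.symm
    rw [zero_add, zero_add] at h
    rw [h]
  | cons x s ih =>
    have main : ∀ s' t' : Multiset α, s + t = s' + t' → Multiset.card s = Multiset.card s' →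
        Q (x ::ₘ s) t = Q (x ::ₘ s') t' := fun s' t' h hc =>
      ih (Q := fun s t => Q (x ::ₘ s) t)
        (fun y z s t => by rw [Multiset.cons_swap, hQ, Multiset.cons_swap]) h hc
    have hx : x ∈ s' + t' := h ▸ by simp
    rcases Multiset.mem_add.1 hx with hx | hx
    · obtain ⟨s', rfl⟩ := Multiset.exists_cons_of_mem hx
      rw [Multiset.cons_add, Multiset.cons_add, Multiset.cons_inj_right] at h
      exact main _ _ h (by simpa using hc)
    · obtain ⟨t', rfl⟩ := Multiset.exists_cons_of_mem hx
      obtain ⟨z, hz⟩ := Multiset.card_pos_iff_exists_mem.1 (hc ▸ by simp : 0 < Multiset.card s')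
      obtain ⟨s', rfl⟩ := Multiset.exists_cons_of_mem hz
      rw [Multiset.cons_add, Multiset.add_cons, Multiset.cons_inj_right] at h
      rw [hQ z x]
      refine main _ _ ?_ (by simpa using hc)
      rw [h, Multiset.cons_add, Multiset.add_cons]

theorem Multiset.exists_add_card_iff {α : Type*} {u : Multiset α} {d : ℕ} :
    (∃ p : Multiset α × Multiset α, u = p.1 + p.2 ∧ Multiset.card p.1 + 1 = d) ↔
      1 ≤ d ∧ d ≤ Multiset.card u + 1 := by
  constructor
  · rintro ⟨p, rfl, rfl⟩
    simp
  · rintro ⟨h, h'⟩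
    obtain ⟨s, t, hu, hs⟩ := Multiset.exists_add_eq_of_le_card (u := u) (k := d - 1) (by omega)
    exact ⟨(s, t), hu, by simp only; omega⟩

namespace MultiNovikovAlgebra

/-! ### Balanced monomials -/

section Balanced

variable {A α β : Type*}

/-- The condition that the monomial formed by the differentiated variables in `q` and the
undifferentiated ones in `u` has one more factor than it has derivatives. -/
def IsBalanced (q : List (α × (A →₀ ℕ))) (u : Multiset α) : Prop :=
  (∀ b ∈ q, b.2 ≠ 0) ∧ Multiset.card u + q.length = (q.map fun b => b.2.degree).sum + 1

theorem IsBalanced.perm {q q' : List (α × (A →₀ ℕ))} {u : Multiset α} (h : IsBalanced q u)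
    (hq : q.Perm q') : IsBalanced q' u :=
  ⟨fun b hb => h.1 b (hq.mem_iff.2 hb), by
    rw [← hq.length_eq, h.2, (hq.map _).sum_eq]⟩

theorem isBalanced_nil {u : Multiset α} :
    IsBalanced ([] : List (α × (A →₀ ℕ))) u ↔ ∃ x, u = {x} := by
  simp [IsBalanced, Multiset.card_eq_one]

theorem IsBalanced.cons {q : List (α × (A →₀ ℕ))} {b : α × (A →₀ ℕ)} {s t : Multiset α}
    (h : IsBalanced q t) (hb : b.2 ≠ 0) (hs : Multiset.card s + 1 = b.2.degree) :
    IsBalanced (b :: q) (s + t) := by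
  refine ⟨by simpa using ⟨hb, fun x y hx => h.1 (x, y) hx⟩, ?_⟩
  have := h.2
  simp only [List.length_cons, List.map_cons, List.sum_cons, Multiset.card_add]
  omega

theorem IsBalanced.exists_add {q : List (α × (A →₀ ℕ))} {b : α × (A →₀ ℕ)} {u : Multiset α}
    (h : IsBalanced (b :: q) u) :
    ∃ s t, u = s + t ∧ b.2 ≠ 0 ∧ Multiset.card s + 1 = b.2.degree ∧ IsBalanced q t := by
  have pos : ∀ m : A →₀ ℕ, m ≠ 0 → 1 ≤ m.degree := fun m hm =>
    Nat.one_le_iff_ne_zero.2 fun h => hm ((Finsupp.degree_eq_zero_iff m).1 h)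
  have hb : b.2 ≠ 0 := h.1 b (by simp)
  have hq : ∀ c ∈ q, c.2 ≠ 0 := fun c hc => h.1 c (by simp [hc])
  have h2 := h.2
  simp only [List.length_cons, List.map_cons, List.sum_cons] at h2
  -- Every differentiated factor carries at least one derivative, so balance leaves enough
  -- undifferentiated factors to fill the head symbol.
  have hle : q.length ≤ (q.map fun b => b.2.degree).sum := by
    simpa using List.length_le_sum_of_one_le (q.map fun b => b.2.degree) (by
      intro i hi
      obtain ⟨c, hc, rfl⟩ := List.mem_map.1 hi
      exact pos _ (hq c hc))
  have := pos _ hb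
  obtain ⟨⟨s, t⟩, hu, hs⟩ := Multiset.exists_add_card_iff (u := u).2 ⟨this, by omega⟩
  dsimp only at hu hs
  subst hu
  refine ⟨s, t, rfl, hb, hs, hq, ?_⟩
  rw [Multiset.card_add] at h2
  omega

theorem IsBalanced.map {q : List (α × (A →₀ ℕ))} {u : Multiset α} (h : IsBalanced q u)
    (f : α → β) : IsBalanced (q.map fun b => (f b.1, b.2)) (u.map f) := by
  refine ⟨?_, ?_⟩
  · intro b hb
    obtain ⟨c, hc, rfl⟩ := List.mem_map.1 hb
    exact h.1 c hc
  · simpa [Function.comp_def] using h.2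

end Balanced

/-! ### Representatives of balanced monomials -/

section Eval

open scoped Classical

variable (K : Type*) {A N : Type*} [CommRing K] [AddCommGroup N] [Module K N]
  [MultiNovikovAlgebra K A N]

/-- The element of a multi-Novikov algebra that represents the differential monomial
`∏ ∂^m y * ∏ u`, the first product being over the pairs `(y, m)` in a list. -/
def monomialEval : List (N × (A →₀ ℕ)) → Multiset N → N
  | [], u => if h : ∃ x, u = {x} then h.choose else 0
  | b :: q, u =>
    if h : ∃ p : Multiset N × Multiset N, u = p.1 + p.2 ∧ Multiset.card p.1 + 1 = b.2.degree then
      symbol (K := K) b.1 b.2 h.choose.1 • monomialEval q h.choose.2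
    else 0

variable {K}

theorem monomialEval_nil (x : N) :
    monomialEval K ([] : List (N × (A →₀ ℕ))) {x} = x := by
  have h : ∃ y, ({x} : Multiset N) = {y} := ⟨x, rfl⟩
  rw [monomialEval, dif_pos h]
  exact (Multiset.singleton_inj.1 h.choose_spec).symm

/-- The exchange property of the tail is a hypothesis so that the induction proving that property
can use this formula. -/
theorem monomialEval_cons_add_of_swap {q : List (N × (A →₀ ℕ))}
    (hq : ∀ h : Multiset N → RightMulAlgebra K A N, IsSymbol h → ∀ x z s t,
      h (x ::ₘ s) • monomialEval K q (z ::ₘ t) = h (z ::ₘ s) • monomialEval K q (x ::ₘ t))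
    (b : N × (A →₀ ℕ)) {s t : Multiset N} (hs : Multiset.card s + 1 = b.2.degree) :
    monomialEval K (b :: q) (s + t) = symbol (K := K) b.1 b.2 s • monomialEval K q t := by
  have h : ∃ p : Multiset N × Multiset N, s + t = p.1 + p.2 ∧
    Multiset.card p.1 + 1 = b.2.degree := ⟨(s, t), rfl, hs⟩
  rw [monomialEval, dif_pos h]
  refine (Multiset.eq_of_forall_swap
    (Q := fun s t => symbol (K := K) b.1 b.2 s • monomialEval K q t)
    (fun x z s t => hq _ (isSymbol_symbol b.1 b.2) x z s t) h.choose_spec.1 ?_).symm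
  have := h.choose_spec.2
  omega

/-- For an empty list this is the symmetry of h. Otherwise z lies either in the argument of the head
symbol, where symbols exchange arguments by commutativity of E, or in the tail, where the induction
hypothesis applies. -/
theorem smul_monomialEval_swap (q : List (N × (A →₀ ℕ)))
    (h : Multiset N → RightMulAlgebra K A N) (hh : IsSymbol h) (x z : N) (s t : Multiset N) :
    h (x ::ₘ s) • monomialEval K q (z ::ₘ t) = h (z ::ₘ s) • monomialEval K q (x ::ₘ t) := by
  induction q generalizing h x z s t with
  | nil =>
    by_cases ht : t = 0
    · subst ht
      rw [Multiset.cons_zero, Multiset.cons_zero, monomialEval_nil, monomialEval_nil, hh.smul_comm]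
    · have : ∀ x : N, monomialEval K ([] : List (N × (A →₀ ℕ))) (x ::ₘ t) = 0 := by
        intro x
        rw [monomialEval, dif_neg]
        rintro ⟨y, hy⟩
        exact ht ((Multiset.cons_eq_cons.1 hy).elim (fun h => h.2) (by simp))
      rw [this, this, smul_zero, smul_zero]
  | cons b q ih =>
    by_cases hd : 1 ≤ b.2.degree ∧ b.2.degree ≤ Multiset.card (z ::ₘ t) + 1
    · obtain ⟨⟨s', t'⟩, hu, hs⟩ := Multiset.exists_add_card_iff.2 hd
      dsimp only at hu hs
      rcases Multiset.mem_add.1 (hu ▸ Multiset.mem_cons_self z t : z ∈ s' + t') with hz | hz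
      · obtain ⟨s', rfl⟩ := Multiset.exists_cons_of_mem hz
        rw [Multiset.cons_add, Multiset.cons_inj_right] at hu
        subst hu
        rw [← Multiset.cons_add, ← Multiset.cons_add, monomialEval_cons_add_of_swap ih b hs,
          monomialEval_cons_add_of_swap ih b (by simpa using hs), ← mul_smul, ← mul_smul,
          (isSymbol_symbol b.1 b.2).mul_comm (g := fun x => h (x ::ₘ s))
            (fun x u => hh.smul_comm x u s)]
      · obtain ⟨t', rfl⟩ := Multiset.exists_cons_of_mem hz
        rw [Multiset.add_cons, Multiset.cons_inj_right] at hu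
        subst hu
        rw [← Multiset.add_cons, ← Multiset.add_cons, monomialEval_cons_add_of_swap ih b hs,
          monomialEval_cons_add_of_swap ih b hs, smul_comm, ih h hh, smul_comm]
    -- The multiset is too small to split, or the degree is zero, so both values are the default 0.
    · rw [monomialEval, dif_neg (by rwa [Multiset.exists_add_card_iff]), monomialEval,
        dif_neg (by rw [Multiset.exists_add_card_iff]; simpa using hd), smul_zero, smul_zero]

theorem monomialEval_cons_add (q : List (N × (A →₀ ℕ))) (b : N × (A →₀ ℕ)) {s t : Multiset N}
    (hs : Multiset.card s + 1 = b.2.degree) :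
    monomialEval K (b :: q) (s + t) = symbol (K := K) b.1 b.2 s • monomialEval K q t :=
  monomialEval_cons_add_of_swap (smul_monomialEval_swap q) b hs

theorem monomialEval_perm {q q' : List (N × (A →₀ ℕ))} (hq : q.Perm q') {u : Multiset N}
    (hu : IsBalanced q u) : monomialEval K q u = monomialEval K q' u := by
  induction hq generalizing u with
  | nil => rfl
  | cons b hq ih =>
    obtain ⟨s, t, rfl, -, hs, ht⟩ := hu.exists_add
    rw [monomialEval_cons_add _ _ hs, monomialEval_cons_add _ _ hs, ih ht]
  | swap b c q =>
    obtain ⟨s, t, rfl, -, hs, ht⟩ := hu.exists_add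
    obtain ⟨s', t, rfl, -, hs', ht⟩ := ht.exists_add
    rw [monomialEval_cons_add _ _ hs, monomialEval_cons_add _ _ hs', add_left_comm,
      monomialEval_cons_add _ _ hs', monomialEval_cons_add _ _ hs, smul_comm]
  | trans hq _ ih ih' => exact (ih hu).trans (ih' (hu.perm hq))

end Eval

/-! ### Images of representatives in a differential algebra -/

section Hom

open scoped Classical

variable {K A N R : Type*} [CommRing K] [AddCommGroup N] [Module K N]
  [MultiNovikovAlgebra K A N] [CommRing R] [Algebra K R] [CommMultiDiffAlgebra K A R]

theorem _root_.Derivation.leibniz_multiset_map_prod {α : Type*} (D : Derivation K R R) (f : α → R)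
    (s : Multiset α) : D (s.map f).prod =
      (s.map fun z => ((s.erase z).map f).prod * D (f z)).sum := by
  induction s using Multiset.induction_on with
  | empty => simp
  | cons x s ih =>
    have : (s.map fun z => (((x ::ₘ s).erase z).map f).prod * D (f z)).sum =
        (s.map fun z => f x * (((s.erase z).map f).prod * D (f z))).sum := by
      refine congrArg _ (Multiset.map_congr rfl fun z hz => ?_)
      rw [Multiset.erase_cons_tail_of_mem hz, Multiset.map_cons, Multiset.prod_cons, mul_assoc]
    rw [Multiset.map_cons, Multiset.prod_cons, Derivation.leibniz, ih, Multiset.map_cons,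
      Multiset.sum_cons, this, Multiset.sum_map_mul_left, Multiset.erase_cons_head, smul_eq_mul,
      smul_eq_mul]
    ring

variable {φ : N →ₗ[K] R} (hφ : ∀ (a : A) (u v : N), φ (novikovOp K a u v) =
  φ u * multiDer K a (φ v))

include hφ

/-- The encoding of symbols is faithful to its model: the recursion for derivatives turns into the
Leibniz rule. The cardinality condition excludes the placeholder values. -/
theorem map_listSymbol_smul (y : N) (l : List A) (s : Multiset N)
    (hs : Multiset.card s + 1 = l.length) (n : N) :
    φ (listSymbol (K := K) y l s • n) =
      (s.map φ).prod * l.foldr (fun a r => multiDer K a r) (φ y) * φ n := by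
  induction l generalizing s n with
  | nil => simp at hs
  | cons a l ih =>
    rw [listSymbol]
    split_ifs with hl
    · subst hl
      obtain rfl : s = 0 := by simpa using hs
      simp [rightMulSymbol, rightMul_smul, hφ, mul_comm]
    · obtain ⟨x, hx⟩ := Multiset.card_pos_iff_exists_mem.1 (show 0 < Multiset.card s by
        have := List.length_pos_iff.2 hl
        simp only [List.length_cons] at hs
        omega)
      obtain ⟨t, rfl⟩ := Multiset.exists_cons_of_mem hx
      have ht : Multiset.card t + 1 = l.length := by simpa using hs
      have hsum : ((t.map fun z => rightMul K A a z * listSymbol y l (x ::ₘ t.erase z)).map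
          fun e => φ (e • n)) = t.map fun z => ((t.erase z).map φ).prod * multiDer K a (φ z) *
            (φ x * l.foldr (fun a r => multiDer K a r) (φ y) * φ n) := by
        rw [Multiset.map_map]
        refine Multiset.map_congr rfl fun z hz => ?_
        rw [Function.comp_apply, mul_smul, rightMul_smul, hφ, ih _ (by
          rw [Multiset.card_cons, Multiset.card_erase_add_one hz, ht])]
        simp only [Multiset.map_cons, Multiset.prod_cons]
        ring
      have hmap := map_multiset_sum (φ.toAddMonoidHom.comp
        ((smulAddHom (RightMulAlgebra K A N) N).flip n))
        (t.map fun z => rightMul K A a z * listSymbol y l (x ::ₘ t.erase z))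
      rw [(isSymbol_listSymbol y l).symbolDer_cons_eq, sub_smul, map_sub, leftDer_smul, map_sub,
        hφ, ih t ht, ih t ht, hφ]
      refine (congrArg _ (hmap.trans (congrArg _ hsum))).trans ?_
      -- The subtracted sum collapses to ∂_a of the product over t, cancelling the unwanted Leibniz
      -- term.
      rw [Multiset.sum_map_mul_right, ← Derivation.leibniz_multiset_map_prod]
      simp only [Derivation.leibniz, smul_eq_mul, Multiset.map_cons, Multiset.prod_cons,
        List.foldr_cons]
      ring

theorem map_symbol_smul (y : N) (m : A →₀ ℕ) (s : Multiset N)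
    (hs : Multiset.card s + 1 = m.degree) (n : N) :
    φ (symbol (K := K) y m s • n) = (s.map φ).prod *
      (Finsupp.toMultiset m).toList.foldr (fun a r => multiDer K a r) (φ y) * φ n :=
  map_listSymbol_smul hφ y _ s (by
    rw [hs, Multiset.length_toList, Finsupp.card_toMultiset]
    rfl) n

theorem map_monomialEval (q : List (N × (A →₀ ℕ))) (u : Multiset N) (hu : IsBalanced q u) :
    φ (monomialEval K q u) = (q.map fun b =>
      (Finsupp.toMultiset b.2).toList.foldr (fun a r => multiDer K a r) (φ b.1)).prod *
        (u.map φ).prod := by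
  induction q generalizing u with
  | nil =>
    obtain ⟨x, rfl⟩ := isBalanced_nil.1 hu
    simp [monomialEval_nil]
  | cons b q ih =>
    obtain ⟨s, t, rfl, -, hs, ht⟩ := hu.exists_add
    rw [monomialEval_cons_add _ _ hs, map_symbol_smul hφ _ _ _ hs, ih _ ht]
    simp only [List.map_cons, List.prod_cons, Multiset.map_add, Multiset.prod_add]
    ring

end Hom

end MultiNovikovAlgebra
end
noncomputable section

namespace MultiNovikovAlgebra

/-! ### The representatives span a subalgebra -/

section Span

open scoped Classical

variable (K A : Type*) {X N : Type*} [CommRing K] [AddCommGroup N] [Module K N]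
  [MultiNovikovAlgebra K A N] (f : X → N)

/-- The elements of a multi-Novikov algebra that represent the differential monomials in the
values of `f`. -/
def monomialValues : Set N :=
  {v | ∃ (q : List (X × (A →₀ ℕ))) (u : Multiset X), IsBalanced q u ∧
    monomialEval K (q.map fun b => (f b.1, b.2)) (u.map f) = v}

/-- The algebra generated by the values of symbols at multisets of values of `f`. -/
def symbolAlgebra : Subalgebra K (RightMulAlgebra K A N) :=
  Algebra.adjoin K {e | ∃ (y : X) (m : A →₀ ℕ) (s : Multiset X), m ≠ 0 ∧
    Multiset.card s + 1 = m.degree ∧ symbol (f y) m (s.map f) = e}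

variable {K A f}

theorem symbol_mem_symbolAlgebra (y : X) {m : A →₀ ℕ} (hm : m ≠ 0) {s : Multiset X}
    (hs : Multiset.card s + 1 = m.degree) :
    symbol (f y) m (s.map f) ∈ symbolAlgebra K A f :=
  Algebra.subset_adjoin ⟨y, m, s, hm, hs, rfl⟩

theorem rightMul_mem_symbolAlgebra (a : A) (y : X) :
    rightMul K A a (f y) ∈ symbolAlgebra K A f := by
  have h := symbol_mem_symbolAlgebra (K := K) (f := f) y (m := Finsupp.single a 1) (by simp)
    (s := 0) (by simp)
  rwa [symbol_single, rightMulSymbol, if_pos (by simp)] at h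

/-- The recursion for ∂_a h is solved for D_{a,x}(h(s)). Only values x of `f` are allowed, so that
the arguments of all symbols remain values of `f`. -/
theorem leftDer_mem_symbolAlgebra (a : A) (x : X) {e : RightMulAlgebra K A N}
    (he : e ∈ symbolAlgebra K A f) : leftDer a (f x) e ∈ symbolAlgebra K A f := by
  induction he using Algebra.adjoin_induction with
  | mem e he =>
    obtain ⟨y, m, s, hm, hs, rfl⟩ := he
    have h := (isSymbol_symbol (K := K) (f y) m).symbolDer_cons_eq a (f x) (s.map f)
    rw [← symbol_add_single _ hm, eq_sub_iff_add_eq] at h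
    rw [← h]
    refine add_mem ?_ (multiset_sum_mem _ ?_)
    · rw [← Multiset.map_cons]
      exact symbol_mem_symbolAlgebra y (by simp) (by simp [hs])
    · intro c hc
      rw [Multiset.map_map] at hc
      obtain ⟨z, hz, rfl⟩ := Multiset.mem_map.1 hc
      refine mul_mem (rightMul_mem_symbolAlgebra a z) ?_
      rw [← Multiset.map_erase_of_mem f s hz, ← Multiset.map_cons]
      exact symbol_mem_symbolAlgebra y hm (by
        rw [Multiset.card_cons, Multiset.card_erase_add_one hz, hs])
  | algebraMap c => simp
  | add e e' _ _ he he' => rw [map_add]; exact add_mem he he'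
  | mul e e' he₀ he'₀ he he' =>
    rw [leftDer_mul]
    exact add_mem (mul_mem he he'₀) (mul_mem he₀ he')

theorem exists_smul_eq_monomialEval (q : List (X × (A →₀ ℕ))) (u : Multiset X)
    (h : IsBalanced q u) : ∃ e ∈ symbolAlgebra K A f, ∃ x : X,
      monomialEval K (q.map fun b => (f b.1, b.2)) (u.map f) = e • f x := by
  induction q generalizing u with
  | nil =>
    obtain ⟨x, rfl⟩ := isBalanced_nil.1 h
    exact ⟨1, one_mem _, x, by simp [monomialEval_nil]⟩
  | cons b q ih =>
    obtain ⟨s, t, rfl, hb, hs, ht⟩ := h.exists_add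
    obtain ⟨e, he, x, hx⟩ := ih t ht
    refine ⟨_, mul_mem (symbol_mem_symbolAlgebra b.1 hb hs) he, x, ?_⟩
    rw [List.map_cons, Multiset.map_add, monomialEval_cons_add _ _ (by simpa using hs), hx,
      mul_smul]

theorem smul_mem_span_monomialValues {e : RightMulAlgebra K A N} (he : e ∈ symbolAlgebra K A f)
    {v : N} (hv : v ∈ Submodule.span K (monomialValues K A f)) :
    e • v ∈ Submodule.span K (monomialValues K A f) := by
  induction he using Algebra.adjoin_induction generalizing v with
  | mem e he =>
    obtain ⟨y, m, s, hm, hs, rfl⟩ := he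
    induction hv using Submodule.span_induction with
    | mem v hv =>
      obtain ⟨q, u, hu, rfl⟩ := hv
      refine Submodule.subset_span ⟨(y, m) :: q, s + u, hu.cons hm hs, ?_⟩
      rw [List.map_cons, Multiset.map_add, monomialEval_cons_add _ _ (by simpa using hs)]
    | zero => rw [smul_zero]; exact zero_mem _
    | add v w _ _ hv hw => rw [smul_add]; exact add_mem hv hw
    | smul c v _ hv => rw [smul_algebra_smul_comm]; exact Submodule.smul_mem _ c hv
  | algebraMap c => rw [algebraMap_smul]; exact Submodule.smul_mem _ c hv
  | add e e' _ _ he he' => rw [add_smul]; exact add_mem (he hv) (he' hv)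
  | mul e e' _ _ he he' => rw [mul_smul]; exact he (he' hv)

/-- A representative has the form e • f x with e in the symbol algebra, so the Leibniz rule gives e
R_{a,f x} + D_{a,f x} e. This yields closure of the span, since v ▷_a w is R_{a,w} applied to v. -/
theorem rightMul_mem_symbolAlgebra_of_mem_span (a : A) {v : N}
    (hv : v ∈ Submodule.span K (monomialValues K A f)) :
    rightMul K A a v ∈ symbolAlgebra K A f := by
  induction hv using Submodule.span_induction with
  | mem v hv =>
    obtain ⟨q, u, hu, rfl⟩ := hv
    obtain ⟨e, he, x, hx⟩ := exists_smul_eq_monomialEval (K := K) (f := f) q u hu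
    rw [hx, rightMul_smul_right]
    exact add_mem (mul_mem he (rightMul_mem_symbolAlgebra a x)) (leftDer_mem_symbolAlgebra a x he)
  | zero => rw [map_zero]; exact zero_mem _
  | add v w _ _ hv hw => rw [map_add]; exact add_mem hv hw
  | smul c v _ hv => rw [map_smul]; exact Subalgebra.smul_mem _ hv c

variable (K A f) in
/-- The differential monomials in the values of `f` span a multi-Novikov subalgebra. -/
def monomialSpan : MultiNovikovSubalgebra K A N where
  toSubmodule := Submodule.span K (monomialValues K A f)
  op_mem a _ _ hx hy :=
    smul_mem_span_monomialValues (rightMul_mem_symbolAlgebra_of_mem_span a hy) hx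

theorem mem_monomialSpan (x : X) : f x ∈ (monomialSpan K A f).toSubmodule :=
  Submodule.subset_span ⟨[], {x}, isBalanced_nil.2 ⟨x, rfl⟩, by
    rw [List.map_nil, Multiset.map_singleton, monomialEval_nil]⟩

end Span

end MultiNovikovAlgebra

namespace MultiNovikovSubalgebra

variable {K A N : Type*} [CommRing K] [AddCommGroup N] [Module K N] [MultiNovikovAlgebra K A N]

theorem subset_adjoin (s : Set N) : s ⊆ (adjoin K A s).toSubmodule := fun x hx => by
  refine Submodule.mem_sInf.2 ?_
  rintro _ ⟨S, rfl, hS⟩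
  exact hS hx

theorem adjoin_le {s : Set N} {S : MultiNovikovSubalgebra K A N}
    (hs : s ⊆ (S.toSubmodule : Set N)) : (adjoin K A s).toSubmodule ≤ S.toSubmodule :=
  sInf_le ⟨S, rfl, hs⟩

end MultiNovikovSubalgebra

/-! ### Generation of the free algebra and monomials of `CDi` -/

namespace Nov

variable {K A X : Type*} [CommRing K]

theorem toSubmodule_eq_top (S : MultiNovikovSubalgebra K A (Nov K A X))
    (hS : ∀ x, of K A x ∈ S.toSubmodule) : S.toSubmodule = ⊤ := by
  have htree : ∀ t : MagTree A X,
      (Mag.novikovIdeal K A X).mkQ (Finsupp.single t 1) ∈ S.toSubmodule := by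
    intro t
    induction t with
    | of x => exact hS x
    | node a s t hs ht =>
      have h := S.op_mem a hs ht
      have h' : novikovOp K a ((Mag.novikovIdeal K A X).mkQ (Finsupp.single s 1))
          ((Mag.novikovIdeal K A X).mkQ (Finsupp.single t 1)) =
          (Mag.novikovIdeal K A X).mkQ (Mag.op K a (Finsupp.single s 1) (Finsupp.single t 1)) :=
        rfl
      rw [h'] at h
      simpa [Mag.op] using h
  rw [eq_top_iff]
  rintro u -
  obtain ⟨u, rfl⟩ := Submodule.mkQ_surjective _ u
  induction u using Finsupp.induction_linear with
  | zero => rw [map_zero]; exact zero_mem _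
  | add u v hu hv => rw [map_add]; exact add_mem hu hv
  | single t c =>
    rw [← mul_one c, ← smul_eq_mul, ← Finsupp.smul_single, map_smul]
    exact Submodule.smul_mem _ c (htree t)

end Nov

namespace CDi

variable {K A X : Type*} [CommRing K]

theorem foldr_multiDer_of (l : List A) (x : X) [DecidableEq A] :
    l.foldr (fun a r => multiDer K a r) (of K A x) =
      MvPolynomial.X (x, Multiset.toFinsupp (l : Multiset A)) := by
  induction l with
  | nil => simp [of]
  | cons a l ih =>
    rw [List.foldr_cons, ih]
    refine (MvPolynomial.mkDerivation_X _ _ _).trans ?_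
    rw [← Multiset.cons_coe, ← Multiset.singleton_add, map_add, Multiset.toFinsupp_singleton,
      add_comm]

theorem prod_map_X {σ : Type*} [DecidableEq σ] (w : Multiset σ) :
    (w.map MvPolynomial.X).prod = MvPolynomial.monomial (Multiset.toFinsupp w) (1 : K) := by
  induction w using Multiset.induction_on with
  | empty => simp
  | cons x w ih =>
    rw [Multiset.map_cons, Multiset.prod_cons, ih, ← Multiset.singleton_add, map_add,
      Multiset.toFinsupp_singleton, MvPolynomial.X, MvPolynomial.monomial_mul, one_mul]

end CDi

/-! ### Injectivity from linear independence of monomials -/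

namespace MultiNovikovAlgebra

open scoped Classical in
theorem map_monomialEval_of {K A X N : Type*} [CommRing K] [AddCommGroup N] [Module K N]
    [MultiNovikovAlgebra K A N] {f : X → N} {φ : N →ₗ[K] CDi K A X}
    (hφ : ∀ (a : A) (u v : N), φ (novikovOp K a u v) = φ u * multiDer K a (φ v))
    (hf : ∀ x, φ (f x) = CDi.of K A x) {q : List (X × (A →₀ ℕ))} {u : Multiset X}
    (h : IsBalanced q u) :
    φ (monomialEval K (q.map fun b => (f b.1, b.2)) (u.map f)) =
      MvPolynomial.monomial (Multiset.toFinsupp ((q : Multiset (X × (A →₀ ℕ))) +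
        u.map fun x => (x, 0))) 1 := by
  rw [map_monomialEval hφ _ _ (h.map f), ← CDi.prod_map_X, Multiset.map_add, Multiset.prod_add,
    Multiset.map_map, Multiset.map_map, List.map_map, Multiset.map_coe, Multiset.prod_coe]
  congr 2
  · refine List.map_congr_left fun b _ => ?_
    simp only [Function.comp_apply, hf, CDi.foldr_multiDer_of, Multiset.coe_toList,
      Finsupp.toMultiset_toFinsupp]
  · refine congrArg (fun g => Multiset.map g u) (funext fun x => ?_)
    simp only [Function.comp_apply, hf, CDi.of]

/-- The entries of `q` are exactly the variables with nonzero exponent, so filtering recovers `q` up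
to order and then `u`. -/
theorem IsBalanced.eq_and_perm {A X : Type*} {q q' : List (X × (A →₀ ℕ))} {u u' : Multiset X}
    (h : IsBalanced q u) (h' : IsBalanced q' u')
    (he : (q : Multiset (X × (A →₀ ℕ))) + u.map (fun x => (x, 0)) =
      (q' : Multiset (X × (A →₀ ℕ))) + u'.map fun x => (x, 0)) : u = u' ∧ q.Perm q' := by
  classical
  have key : ∀ {q : List (X × (A →₀ ℕ))} {u : Multiset X}, IsBalanced q u →
      Multiset.filter (fun b => b.2 ≠ 0) ((q : Multiset (X × (A →₀ ℕ))) +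
        u.map fun x => (x, 0)) = q := by
    intro q u h
    rw [Multiset.filter_add, Multiset.filter_eq_self.2 (by simpa using h.1),
      Multiset.filter_eq_nil.2 (by simp), add_zero]
  have hq : (q : Multiset (X × (A →₀ ℕ))) = q' := by rw [← key h, he, key h']
  rw [hq, add_right_inj] at he
  refine ⟨?_, Multiset.coe_eq_coe.1 hq⟩
  simpa [Multiset.map_map, Function.comp_def] using congrArg (Multiset.map Prod.fst) he

/-- The map is injective on the spanning set: an equal image means the same monomial, hence the same
representative by `monomialEval_perm`. The images are distinct monomials, so no nontrivial
combination of representatives is killed. -/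
theorem injective_of_span_monomialValues {K A X N : Type*} [CommRing K] [Nontrivial K]
    [AddCommGroup N] [Module K N] [MultiNovikovAlgebra K A N] {f : X → N} {φ : N →ₗ[K] CDi K A X}
    (hφ : ∀ (a : A) (u v : N), φ (novikovOp K a u v) = φ u * multiDer K a (φ v))
    (hf : ∀ x, φ (f x) = CDi.of K A x)
    (hspan : Submodule.span K (monomialValues K A f) = ⊤) : Function.Injective φ := by
  classical
  have hw : ∀ v : monomialValues K A f, ∃ w, φ v = MvPolynomial.monomial w 1 := by
    rintro ⟨_, q, u, h, rfl⟩
    exact ⟨_, map_monomialEval_of hφ hf h⟩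
  have hinj : ∀ v v' : monomialValues K A f, φ v = φ v' → v = v' := by
    rintro ⟨_, q, u, h, rfl⟩ ⟨_, q', u', h', rfl⟩ he
    rw [map_monomialEval_of hφ hf h, map_monomialEval_of hφ hf h'] at he
    obtain ⟨rfl, hq⟩ := h.eq_and_perm h' (Multiset.toFinsupp.injective
      (MvPolynomial.monomial_left_injective one_ne_zero he))
    exact Subtype.ext (monomialEval_perm (hq.map _) (h.map f))
  choose w hw using hw
  have hli : LinearIndependent K fun v : monomialValues K A f => φ v := by
    have h := (MvPolynomial.basisMonomials (X × (A →₀ ℕ)) K).linearIndependent.comp w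
      (fun v v' h => hinj v v' (by rw [hw, hw, h]))
    simpa only [Function.comp_def, MvPolynomial.coe_basisMonomials, ← hw] using h
  rw [← LinearMap.ker_eq_bot, LinearMap.ker_eq_bot']
  intro n hn
  have hmem : n ∈ Submodule.span K (Set.range ((↑) : monomialValues K A f → N)) := by
    rw [Subtype.range_coe, hspan]
    trivial
  obtain ⟨c, rfl⟩ := Finsupp.mem_span_range_iff_exists_finsupp.1 hmem
  have hc : c = 0 := linearIndependent_iff.1 hli c (by
    rw [← hn, map_finsuppSum]
    simp [Finsupp.linearCombination_apply])
  rw [hc, Finsupp.sum_zero_index]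

end MultiNovikovAlgebra
end

theorem theorem3p2 (K A X : Type*) [Field K] :
    ∃ e : Nov K A X ≃ₗ[K]
        (MultiNovikovSubalgebra.adjoin K A (Set.range (CDi.of K A (X := X)))).toSubmodule,
      (∀ (a : A) (u v : Nov K A X), e (novikovOp K a u v) = novikovOp K a (e u) (e v)) ∧
        ∀ x : X, (e (Nov.of K A x) : CDi K A X) = CDi.of K A x := by
  obtain ⟨φ, ⟨hφ, hof⟩, -⟩ := Nov.existsUnique_lift (K := K) (A := A) (CDi.of K A (X := X))
  have hinj : Function.Injective φ :=
    MultiNovikovAlgebra.injective_of_span_monomialValues (f := Nov.of K A) hφ hof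
      (Nov.toSubmodule_eq_top (MultiNovikovAlgebra.monomialSpan K A (Nov.of K A))
        MultiNovikovAlgebra.mem_monomialSpan)
  have hrange : LinearMap.range φ =
      (MultiNovikovSubalgebra.adjoin K A (Set.range (CDi.of K A (X := X)))).toSubmodule := by
    apply le_antisymm
    -- The preimage of the generated subalgebra is a subalgebra containing the generators, hence
    -- everything.
    · rw [LinearMap.range_eq_map, Submodule.map_le_iff_le_comap, top_le_iff]
      exact Nov.toSubmodule_eq_top
        { toSubmodule := (MultiNovikovSubalgebra.adjoin K A
            (Set.range (CDi.of K A (X := X)))).toSubmodule.comap φ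
          op_mem := fun a x y hx hy => by
            rw [Submodule.mem_comap, hφ]
            exact MultiNovikovSubalgebra.op_mem _ a hx hy }
        (fun x => by
          rw [Submodule.mem_comap, hof]
          exact MultiNovikovSubalgebra.subset_adjoin _ ⟨x, rfl⟩)
    · refine MultiNovikovSubalgebra.adjoin_le
        (S := { toSubmodule := LinearMap.range φ, op_mem := ?_ }) ?_
      · rintro a _ _ ⟨x, rfl⟩ ⟨y, rfl⟩
        exact ⟨novikovOp K a x y, hφ a x y⟩
      · rintro _ ⟨x, rfl⟩
        exact ⟨Nov.of K A x, hof x⟩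
  exact ⟨(LinearEquiv.ofInjective φ hinj).trans (LinearEquiv.ofEq _ _ hrange),
    fun a u v => Subtype.ext (hφ a u v), hof⟩
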